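/- Let $\mathcal H_S,\mathcal H_E$ be finite-dimensional, let $B,C$ be Hermitian on $\mathcal H_S$, $H_E$ Hermitian on $\mathcal H_E$, $H_I$ Hermitian on $\mathcal H_S\otimes\mathcal H_E$, let $\rho_0,\rho_E$ be density matrices on $\mathcal H_S$, $\mathcal H_E$, and let $t_f>0$. Write $\langle X,Y\rangle=\mathrm{Tr}(X^\dagger Y)$, $\mathcal K_X=-i[X,\bullet\,]$ and, for $v\in[0,1]$, $\mathcal L_v=\mathcal K_{H_{\rm tot}(v)}$ with $H_{\rm tot}(v)=(C+v(B-C))\otimes 1+H_I+1\otimes H_E$. Admissible controls are the Lebesgue measurable functions $s:[0,t_f]\to[0,1]$; the corresponding trajectory $\rho$ is the absolutely continuous solution of $\dot\rho=\mathcal L_{s(t)}\rho$, $\rho(0)=\rho_0\otimes\rho_E$. Let $(s,\rho)$ be an optimal pair, i.e. one that minimizes the cost $J=\mathrm{Tr}[(C\otimes 1)\rho(t_f)]$ among all admissible pairs. Then there is a Hermitian co-state $p$, i.e. an absolutely continuous solution of $\dot p=-\mathcal L_{s(t)}^\dagger p$, $p(t_f)=-C\otimes 1$ (where $\mathcal L^\dagger$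 is the adjoint for $\langle\cdot,\cdot\rangle$), and every such $p$ has the following properties. If $C\neq 0$ then $p(t)\ne 0$ for all $t\in[0,t_f]$. The function $\varphi(t)=\langle p(t),\mathcal K_{(B-C)\otimes 1}\rho(t)\rangle$ is real-valued on $[0,t_f]$. Call a nondegenerate subinterval $I$ of $[0,t_f]$ an arc, and call it a singular arc if for every $t\in I$ the value $\langle p(t),\mathcal L_v\rho(t)\rangle$ of the control Hamiltonian does not depend on $v\in[0,1]$. 1. (Bang arcs.) On every arc on which $\varphi<0$ one has $s=0$ almost everywhere, and on every arc on which $\varphi>0$ one has $s=1$ almost everywhere. 2. (Singular arcs.) On every singular arc, $\langle p,\mathcal K_{C\otimes 1}\rho\rangle\equiv\langle p,\mathcal K_{B\otimes 1}\rho\rangle$; this equality holds more generally at every $t\in[0,t_f]$ with $\varphi(t)=0$. 3. (Alternation.) The maximal arcs on which $\varphi<0$, the maximal arcs on which $\varphi>0$ and the maximal singular arcs are together countably many and pairwise disjoint. Those of the first kind have union $\{t\in[0,t_f]:\varphi(t)<0\}$, those of the second kind have union $\{t\in[0,t_f]:\varphi(t)>0\}$, and the points of $[0,t_f]$ that lie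 in none of these arcs form a nowhere dense set. -/

import Mathlib

open scoped Kronecker
open MeasureTheory Set

noncomputable section

namespace OpenAnneal

/-- Hilbert-Schmidt scalar product `⟨X, Y⟩ = Tr (X† Y)`. -/
def hsInner {n : Type*} [Fintype n] (X Y : Matrix n n ℂ) : ℂ :=
  (X.conjTranspose * Y).trace

/-- The superoperator `K_X = -i [X, •]`. -/
def K {n : Type*} [Fintype n] [DecidableEq n] (X : Matrix n n ℂ) :
    Matrix n n ℂ →ₗ[ℂ] Matrix n n ℂ :=
  (-Complex.I) • (LinearMap.mulLeft ℂ X - LinearMap.mulRight ℂ X)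

theorem K_apply {n : Type*} [Fintype n] [DecidableEq n] (X Y : Matrix n n ℂ) :
    K X Y = (-Complex.I) • (X * Y - Y * X) := by
  simp [K]

/-- Hilbert-Schmidt adjoint `L†` of a superoperator, through its matrix entries
`(L† Y)_{ij} = ⟨E_{ij}, L† Y⟩ = conj ⟨Y, L E_{ij}⟩`. -/
def hsAdjoint {n : Type*} [Fintype n] [DecidableEq n]
    (L : Matrix n n ℂ →ₗ[ℂ] Matrix n n ℂ) (Y : Matrix n n ℂ) : Matrix n n ℂ :=
  Matrix.of fun i j => star (hsInner Y (L (Matrix.single i j 1)))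

/-- The defining property of the Hilbert-Schmidt adjoint. -/
theorem hsInner_hsAdjoint {n : Type*} [Fintype n] [DecidableEq n]
    (L : Matrix n n ℂ →ₗ[ℂ] Matrix n n ℂ) (X Y : Matrix n n ℂ) :
    hsInner (hsAdjoint L Y) X = hsInner Y (L X) := by
  have hX : L X = ∑ i, ∑ j, X i j • L (Matrix.single i j 1) := by
    conv_lhs => rw [Matrix.matrix_eq_sum_single X]
    rw [map_sum]
    refine Finset.sum_congr rfl fun i _ => ?_
    rw [map_sum]
    refine Finset.sum_congr rfl fun j _ => ?_
    rw [← map_smul, Matrix.smul_single, smul_eq_mul, mul_one]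
  have h1 : hsInner Y (L X) = ∑ i, ∑ j, X i j * hsInner Y (L (Matrix.single i j 1)) := by
    rw [hX]
    simp only [hsInner, Matrix.mul_sum, Matrix.trace_sum, Matrix.mul_smul, Matrix.trace_smul,
      smul_eq_mul]
  rw [h1]
  simp only [hsInner, hsAdjoint, Matrix.trace, Matrix.diag_apply, Matrix.mul_apply,
    Matrix.conjTranspose_apply, Matrix.of_apply, star_star]
  rw [Finset.sum_comm]
  refine Finset.sum_congr rfl fun i _ => Finset.sum_congr rfl fun j _ => ?_
  ring

open scoped ComplexOrder in
/-- Density matrices: positive semidefinite with unit trace. -/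
def IsDensity {n : Type*} [Fintype n] (ρ : Matrix n n ℂ) : Prop :=
  ρ.PosSemidef ∧ ρ.trace = 1

/-- A finite-dimensional system `S` with driver `B` and target `C`, coupled to a
finite-dimensional environment `E`. -/
structure OpenSystem (S E : Type*) [Fintype S] [Fintype E] where
  B : Matrix S S ℂ
  C : Matrix S S ℂ
  HI : Matrix (S × E) (S × E) ℂ
  HE : Matrix E E ℂ
  ρ₀ : Matrix S S ℂ
  ρE : Matrix E E ℂ
  hB : B.IsHermitian
  hC : C.IsHermitian
  hHI : HI.IsHermitian
  hHE : HE.IsHermitian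
  hρ₀ : IsDensity ρ₀
  hρE : IsDensity ρE

variable {S E : Type*} [Fintype S] [Fintype E] [DecidableEq S] [DecidableEq E]

/-- `X ⊗ 1_E`. -/
def onSystem (E : Type*) [DecidableEq E] {S : Type*} (X : Matrix S S ℂ) :
    Matrix (S × E) (S × E) ℂ :=
  X ⊗ₖ (1 : Matrix E E ℂ)

namespace OpenSystem

/-- Total Hamiltonian for the control value `v`:
`(C + v (B - C)) ⊗ 1 + H_I + 1 ⊗ H_E`. -/
def Htot (sys : OpenSystem S E) (v : ℝ) : Matrix (S × E) (S × E) ℂ :=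
  onSystem E (sys.C + (v : ℂ) • (sys.B - sys.C)) + sys.HI + (1 : Matrix S S ℂ) ⊗ₖ sys.HE

/-- The generator `L = K_{Htot}` for the control value `v`. -/
def L (sys : OpenSystem S E) (v : ℝ) :
    Matrix (S × E) (S × E) ℂ →ₗ[ℂ] Matrix (S × E) (S × E) ℂ :=
  K (sys.Htot v)

/-- `(s, ρ)` is an admissible pair on `[0, tf]`: a Lebesgue measurable control with values
in `[0, 1]` and the absolutely continuous (Carathéodory) solution `ρ` of `ρ' = L ρ`,
`ρ 0 = ρ₀ ⊗ ρE`, written as an integral equation, entry by entry. -/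
structure IsAdmissible (sys : OpenSystem S E) (tf : ℝ) (s : ℝ → ℝ)
    (ρ : ℝ → Matrix (S × E) (S × E) ℂ) : Prop where
  measurable : AEMeasurable s (volume.restrict (Icc 0 tf))
  mem : ∀ t ∈ Icc 0 tf, s t ∈ Icc (0 : ℝ) 1
  continuousOn : ContinuousOn ρ (Icc 0 tf)
  eq : ∀ t ∈ Icc 0 tf, ∀ i j,
    ρ t i j = (sys.ρ₀ ⊗ₖ sys.ρE) i j + ∫ τ in (0 : ℝ)..t, sys.L (s τ) (ρ τ) i j

/-- The cost `Tr [(C ⊗ 1) ρ]` of a final state (a real number for Hermitian `ρ`). -/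
def cost (sys : OpenSystem S E) (ρf : Matrix (S × E) (S × E) ℂ) : ℝ :=
  ((onSystem E sys.C * ρf).trace).re

/-- `(s, ρ)` is an optimal pair for the fixed final time `tf`. -/
def IsOptimal (sys : OpenSystem S E) (tf : ℝ) (s : ℝ → ℝ)
    (ρ : ℝ → Matrix (S × E) (S × E) ℂ) : Prop :=
  sys.IsAdmissible tf s ρ ∧
    ∀ s' ρ', sys.IsAdmissible tf s' ρ' → sys.cost (ρ tf) ≤ sys.cost (ρ' tf)

/-- `p` is a co-state for the control `s`: a Hermitian, absolutely continuous solution of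
`p' = -L† p`, `p tf = -C ⊗ 1`. -/
structure IsCostate (sys : OpenSystem S E) (tf : ℝ) (s : ℝ → ℝ)
    (p : ℝ → Matrix (S × E) (S × E) ℂ) : Prop where
  hermitian : ∀ t ∈ Icc 0 tf, (p t).IsHermitian
  continuousOn : ContinuousOn p (Icc 0 tf)
  eq : ∀ t ∈ Icc 0 tf, ∀ i j,
    p t i j = (-onSystem E sys.C) i j + ∫ τ in t..tf, hsAdjoint (sys.L (s τ)) (p τ) i j

/-- The PMP control Hamiltonian `⟨p, L ρ⟩` at the control value `v`. -/
def pmpH (sys : OpenSystem S E) (p ρ : Matrix (S × E) (S × E) ℂ) (v : ℝ) : ℂ :=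
  hsInner p (sys.L v ρ)

/-- The function `⟨p, K_{(B - C) ⊗ 1} ρ⟩`. -/
def switching (sys : OpenSystem S E) (p ρ : Matrix (S × E) (S × E) ℂ) : ℂ :=
  hsInner p (K (onSystem E (sys.B - sys.C)) ρ)

/-- An arc: a nondegenerate subinterval of `[0, tf]`. -/
def IsArc (tf : ℝ) (I : Set ℝ) : Prop :=
  I ⊆ Icc 0 tf ∧ I.OrdConnected ∧ I.Nontrivial

/-- An arc on which `⟨p, K_{(B - C) ⊗ 1} ρ⟩ < 0`. -/
def IsNegArc (sys : OpenSystem S E) (tf : ℝ) (p ρ : ℝ → Matrix (S × E) (S × E) ℂ)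
    (I : Set ℝ) : Prop :=
  IsArc tf I ∧ ∀ t ∈ I, (sys.switching (p t) (ρ t)).re < 0

/-- An arc on which `⟨p, K_{(B - C) ⊗ 1} ρ⟩ > 0`. -/
def IsPosArc (sys : OpenSystem S E) (tf : ℝ) (p ρ : ℝ → Matrix (S × E) (S × E) ℂ)
    (I : Set ℝ) : Prop :=
  IsArc tf I ∧ ∀ t ∈ I, 0 < (sys.switching (p t) (ρ t)).re

/-- A singular arc: one on which the PMP control Hamiltonian does not depend on the control. -/
def IsSingularArc (sys : OpenSystem S E) (tf : ℝ) (p ρ : ℝ → Matrix (S × E) (S × E) ℂ)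
    (I : Set ℝ) : Prop :=
  IsArc tf I ∧ ∀ t ∈ I, ∀ v ∈ Icc (0 : ℝ) 1, ∀ w ∈ Icc (0 : ℝ) 1,
    sys.pmpH (p t) (ρ t) v = sys.pmpH (p t) (ρ t) w

/-- The maximal arcs on which `⟨p, K_{(B - C) ⊗ 1} ρ⟩ < 0`. -/
def negArcs (sys : OpenSystem S E) (tf : ℝ) (p ρ : ℝ → Matrix (S × E) (S × E) ℂ) :
    Set (Set ℝ) :=
  {I | Maximal (sys.IsNegArc tf p ρ) I}

/-- The maximal arcs on which `⟨p, K_{(B - C) ⊗ 1} ρ⟩ > 0`. -/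
def posArcs (sys : OpenSystem S E) (tf : ℝ) (p ρ : ℝ → Matrix (S × E) (S × E) ℂ) :
    Set (Set ℝ) :=
  {I | Maximal (sys.IsPosArc tf p ρ) I}

/-- The maximal singular arcs. -/
def singularArcs (sys : OpenSystem S E) (tf : ℝ) (p ρ : ℝ → Matrix (S × E) (S × E) ℂ) :
    Set (Set ℝ) :=
  {I | Maximal (sys.IsSingularArc tf p ρ) I}

/-- `[0, tf]` is an alternation of arcs: the maximal arcs of the three kinds are countably many
and pairwise disjoint, those of the first two kinds fill exactly the times at which
`⟨p, K_{(B - C) ⊗ 1} ρ⟩` is negative, respectively positive, and all of them together leave out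
only a nowhere dense set of switching times. -/
def IsAlternation (sys : OpenSystem S E) (tf : ℝ)
    (p ρ : ℝ → Matrix (S × E) (S × E) ℂ) : Prop :=
  (sys.negArcs tf p ρ ∪ sys.posArcs tf p ρ ∪ sys.singularArcs tf p ρ).Countable ∧
  (sys.negArcs tf p ρ ∪ sys.posArcs tf p ρ ∪ sys.singularArcs tf p ρ).PairwiseDisjoint id ∧
  ⋃₀ sys.negArcs tf p ρ = {t ∈ Icc 0 tf | (sys.switching (p t) (ρ t)).re < 0} ∧
  ⋃₀ sys.posArcs tf p ρ = {t ∈ Icc 0 tf | 0 < (sys.switching (p t) (ρ t)).re} ∧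
  IsNowhereDense
    (Icc 0 tf \ ⋃₀ (sys.negArcs tf p ρ ∪ sys.posArcs tf p ρ ∪ sys.singularArcs tf p ρ))

end OpenSystem

end OpenAnneal

end

open OpenAnneal

/-! For Hermitian `X` the superoperator `K X` is skew-adjoint for the real scalar product `Re Tr (X†
Y)`. With matrices read as vectors, the dynamics is x' = (A + s D) x with A, D skew. As -L† = L, a
co-state solves the same equation, with a terminal instead of an initial value.

Let x, y be trajectories with controls s, r and a common initial value, let p be a co-state for s,
and let the cost be ⟪q, x(T)⟫ with q = -p(T). By skewness ⟪p, y⟫' = (r - s)⟪p, D y⟫ (`inner_skew`),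
so the cost increment is exactly -∫ (r - s)⟪p, D y⟫. For r = s + ε (w - s), optimality gives ∫ (w -
s)⟪p, D y⟫ ≤ 0. Norms are conserved, hence y → x uniformly as ε → 0, and the inequality passes to φ
= ⟪p, D x⟫ (`integral_variation_nonpos`). Taking for w(t) a maximizer of v ↦ v φ(t) makes the
integrand nonnegative, hence zero almost everywhere (`bang_of_optimal`). No needle variations are
needed.

The alternation uses only the continuity of φ (`alternation_of_continuousOn`). The control
Hamiltonian is affine in v with slope φ, so singular arcs are the arcs on which φ = 0. -/

namespace OpenAnneal

open scoped Topology RealInnerProductSpace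

/-! ### Primitives of bounded integrable functions. -/

/-- `x` is a Lipschitz function on `[0, T]` with the bounded almost everywhere derivative `f`. -/
structure IsBoundedPrimitive {V : Type*} [NormedAddCommGroup V] [NormedSpace ℝ V]
    (T : ℝ) (x f : ℝ → V) : Prop where
  integrableOn : IntegrableOn f (Icc 0 T)
  bounded : ∃ M, ∀ t ∈ Icc 0 T, ‖f t‖ ≤ M
  eq : ∀ t ∈ Icc 0 T, x t = x 0 + ∫ τ in (0 : ℝ)..t, f τ

/-- Measurable controls on `[0, T]` with values in `[0, 1]`. -/
structure IsControl (T : ℝ) (s : ℝ → ℝ) : Prop where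
  measurable : AEMeasurable s (volume.restrict (Icc 0 T))
  mem : ∀ t ∈ Icc 0 T, s t ∈ Icc (0 : ℝ) 1

theorem intervalIntegrable_of_integrableOn_Icc {V : Type*} [NormedAddCommGroup V]
    {T : ℝ} {f : ℝ → V} (hf : IntegrableOn f (Icc 0 T)) {a b : ℝ} (ha : a ∈ Icc 0 T)
    (hb : b ∈ Icc 0 T) : IntervalIntegrable f volume a b :=
  (hf.mono_set (ordConnected_Icc.uIcc_subset ha hb)).intervalIntegrable

namespace IsBoundedPrimitive

variable {V : Type*} [NormedAddCommGroup V] [NormedSpace ℝ V] {T : ℝ} {x y f g : ℝ → V}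

theorem eq_add_integral (hx : IsBoundedPrimitive T x f) {a b : ℝ} (ha : a ∈ Icc 0 T)
    (hb : b ∈ Icc 0 T) : x b = x a + ∫ τ in a..b, f τ := by
  have h0 : (0 : ℝ) ∈ Icc 0 T := ⟨le_rfl, ha.1.trans ha.2⟩
  rw [hx.eq a ha, hx.eq b hb, add_assoc, intervalIntegral.integral_add_adjacent_intervals
    (intervalIntegrable_of_integrableOn_Icc hx.integrableOn h0 ha)
    (intervalIntegrable_of_integrableOn_Icc hx.integrableOn ha hb)]

theorem exists_lipschitzOnWith (hx : IsBoundedPrimitive T x f) :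
    ∃ M, LipschitzOnWith M x (Icc 0 T) := by
  obtain ⟨M, hM⟩ := hx.bounded
  refine ⟨M.toNNReal, LipschitzOnWith.of_dist_le_mul fun a ha b hb => ?_⟩
  rw [dist_comm, hx.eq_add_integral ha hb, dist_eq_norm, add_sub_cancel_left, dist_comm,
    Real.dist_eq]
  refine intervalIntegral.norm_integral_le_of_norm_le_const fun t ht => ?_
  exact (hM t (ordConnected_Icc.uIcc_subset ha hb (uIoc_subset_uIcc ht))).trans
    (Real.le_coe_toNNReal M)

theorem continuousOn (hx : IsBoundedPrimitive T x f) : ContinuousOn x (Icc 0 T) :=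
  hx.exists_lipschitzOnWith.choose_spec.continuousOn

theorem sub (hx : IsBoundedPrimitive T x f) (hy : IsBoundedPrimitive T y g) :
    IsBoundedPrimitive T (fun t => x t - y t) (fun t => f t - g t) where
  integrableOn := hx.integrableOn.sub hy.integrableOn
  bounded := by
    obtain ⟨M, hM⟩ := hx.bounded
    obtain ⟨N, hN⟩ := hy.bounded
    exact ⟨M + N, fun t ht => (norm_sub_le _ _).trans (add_le_add (hM t ht) (hN t ht))⟩
  eq t ht := by
    have h0 : (0 : ℝ) ∈ Icc 0 T := ⟨le_rfl, ht.1.trans ht.2⟩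
    rw [intervalIntegral.integral_sub
      (intervalIntegrable_of_integrableOn_Icc hx.integrableOn h0 ht)
      (intervalIntegrable_of_integrableOn_Icc hy.integrableOn h0 ht), hx.eq t ht, hy.eq t ht]
    abel

theorem congr (hx : IsBoundedPrimitive T x f) (h : ∀ t ∈ Icc 0 T, f t = g t) :
    IsBoundedPrimitive T x g where
  integrableOn := hx.integrableOn.congr_fun h measurableSet_Icc
  bounded := by
    obtain ⟨M, hM⟩ := hx.bounded
    exact ⟨M, fun t ht => h t ht ▸ hM t ht⟩
  eq t ht := by
    rw [hx.eq t ht]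
    congr 1
    refine intervalIntegral.integral_congr fun τ hτ => h τ ?_
    exact ordConnected_Icc.uIcc_subset ⟨le_rfl, ht.1.trans ht.2⟩ ht hτ

theorem map {W : Type*} [NormedAddCommGroup W] [NormedSpace ℝ W] [CompleteSpace V]
    [CompleteSpace W] (hx : IsBoundedPrimitive T x f) (A : V →L[ℝ] W) :
    IsBoundedPrimitive T (fun t => A (x t)) (fun t => A (f t)) where
  integrableOn := A.integrable_comp hx.integrableOn
  bounded := by
    obtain ⟨M, hM⟩ := hx.bounded
    exact ⟨‖A‖ * M, fun t ht => A.le_opNorm_of_le (hM t ht)⟩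
  eq t ht := by
    rw [hx.eq t ht, map_add, A.intervalIntegral_comp_comm
      (intervalIntegrable_of_integrableOn_Icc hx.integrableOn ⟨le_rfl, ht.1.trans ht.2⟩ ht)]

/-- Time reversal reduces terminal value problems, such as that of the co-state, to initial value
problems. -/
theorem reverse (hx : IsBoundedPrimitive T x f) (hT : 0 ≤ T) :
    IsBoundedPrimitive T (fun t => x (T - t)) (fun t => -f (T - t)) where
  integrableOn := by
    have := (intervalIntegrable_iff_integrableOn_Icc_of_le hT).2 hx.integrableOn
    have := (this.comp_sub_left T).symm
    simp only [sub_self, sub_zero] at this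
    exact ((intervalIntegrable_iff_integrableOn_Icc_of_le hT).1 this).neg
  bounded := by
    obtain ⟨M, hM⟩ := hx.bounded
    exact ⟨M, fun t ht => by
      rw [norm_neg]; exact hM _ ⟨by linarith [ht.2], by linarith [ht.1]⟩⟩
  eq t ht := by
    simp only [sub_zero, intervalIntegral.integral_neg, intervalIntegral.integral_comp_sub_left]
    rw [← intervalIntegral.integral_symm]
    exact hx.eq_add_integral ⟨hT, le_rfl⟩ ⟨by linarith [ht.2], by linarith [ht.1]⟩

end IsBoundedPrimitive

/-! ### The product rule for scalar products. -/

section Hilbert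

variable {V : Type*} [NormedAddCommGroup V] [InnerProductSpace ℝ V] [CompleteSpace V]
  {T : ℝ} {x y f g : ℝ → V}

/-- Product rule for the scalar product of two Lipschitz functions. -/
theorem IsBoundedPrimitive.inner (hT : 0 ≤ T) (hx : IsBoundedPrimitive T x f)
    (hy : IsBoundedPrimitive T y g) :
    IsBoundedPrimitive T (fun t => ⟪x t, y t⟫) (fun t => ⟪f t, y t⟫ + ⟪x t, g t⟫) := by
  obtain ⟨Mx, hMx⟩ := hx.exists_lipschitzOnWith
  obtain ⟨My, hMy⟩ := hy.exists_lipschitzOnWith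
  obtain ⟨Nx, hNx⟩ := isCompact_Icc.exists_bound_of_continuousOn hMx.continuousOn
  obtain ⟨Ny, hNy⟩ := isCompact_Icc.exists_bound_of_continuousOn hMy.continuousOn
  obtain ⟨Mf, hMf⟩ := hx.bounded
  obtain ⟨Mg, hMg⟩ := hy.bounded
  set h : ℝ → ℝ := fun t => ⟪f t, y t⟫ + ⟪x t, g t⟫ with hh
  have hbound : ∀ t ∈ Icc 0 T, ‖h t‖ ≤ Mf * Ny + Nx * Mg := by
    intro t ht
    refine (norm_add_le _ _).trans (add_le_add ?_ ?_)
    · exact (norm_inner_le_norm _ _).trans (mul_le_mul (hMf t ht) (hNy t ht) (norm_nonneg _)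
        ((norm_nonneg _).trans (hMf t ht)))
    · exact (norm_inner_le_norm _ _).trans (mul_le_mul (hNx t ht) (hMg t ht) (norm_nonneg _)
        ((norm_nonneg _).trans (hNx t ht)))
  have hmeas : AEStronglyMeasurable h (volume.restrict (Icc 0 T)) :=
    (hx.integrableOn.aestronglyMeasurable.inner
      (hy.continuousOn.aestronglyMeasurable measurableSet_Icc)).add
    ((hx.continuousOn.aestronglyMeasurable measurableSet_Icc).inner
      hy.integrableOn.aestronglyMeasurable)
  have hint : IntegrableOn h (Icc 0 T) :=
    IntegrableOn.of_bound measure_Icc_lt_top hmeas _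
      ((ae_restrict_iff' measurableSet_Icc).2 (Filter.Eventually.of_forall hbound))
  refine ⟨hint, ⟨_, hbound⟩, ?_⟩
  have h0 : (0 : ℝ) ∈ Icc 0 T := ⟨le_rfl, hT⟩
  have hT' : T ∈ Icc 0 T := ⟨hT, le_rfl⟩
  have hu : uIcc 0 T = Icc 0 T := uIcc_of_le hT
  set H : ℝ → ℝ := fun t => ∫ τ in (0 : ℝ)..t, h τ with hHdef
  have hH : IsBoundedPrimitive T H h := ⟨hint, ⟨_, hbound⟩, fun t _ => by simp [hHdef]⟩
  obtain ⟨MH, hMH⟩ := hH.exists_lipschitzOnWith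
  -- The integral formulas agree with `x` and `y` on `[0, T]`, and their two-sided derivatives
  -- almost everywhere come directly from Lebesgue differentiation.
  set X : ℝ → V := fun t => x 0 + ∫ τ in (0 : ℝ)..t, f τ with hX
  set Y : ℝ → V := fun t => y 0 + ∫ τ in (0 : ℝ)..t, g τ with hY
  have hXx : ∀ t ∈ Icc 0 T, X t = x t := fun t ht => (hx.eq t ht).symm
  have hYy : ∀ t ∈ Icc 0 T, Y t = y t := fun t ht => (hy.eq t ht).symm
  -- The difference of the two sides of the product rule is Lipschitz, hence absolutely continuous;
  -- its derivative vanishes almost everywhere, so it is constant.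
  have hlip : LipschitzOnWith (Mx * Ny.toNNReal + Nx.toNNReal * My + MH)
      (fun t => ⟪X t, Y t⟫ - H t) (uIcc 0 T) := by
    rw [hu]
    refine LipschitzOnWith.of_dist_le_mul fun a ha b hb => ?_
    rw [hXx a ha, hYy a ha, hXx b hb, hYy b hb]
    have e1 : ⟪x a, y a⟫ - H a - (⟪x b, y b⟫ - H b)
        = ⟪x a - x b, y a⟫ + ⟪x b, y a - y b⟫ - (H a - H b) := by
      rw [inner_sub_left, inner_sub_right]; ring
    rw [dist_eq_norm, e1]
    have n1 : ‖x a - x b‖ ≤ Mx * dist a b := by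
      rw [← dist_eq_norm]; exact hMx.dist_le_mul a ha b hb
    have n2 : ‖y a - y b‖ ≤ My * dist a b := by
      rw [← dist_eq_norm]; exact hMy.dist_le_mul a ha b hb
    have n3 : ‖H a - H b‖ ≤ MH * dist a b := by
      rw [← dist_eq_norm]; exact hMH.dist_le_mul a ha b hb
    have n4 : ‖⟪x a - x b, y a⟫‖ ≤ Mx * dist a b * Ny.toNNReal :=
      (norm_inner_le_norm _ _).trans (mul_le_mul n1 ((hNy a ha).trans
        (Real.le_coe_toNNReal _)) (norm_nonneg _) (by positivity))
    have n5 : ‖⟪x b, y a - y b⟫‖ ≤ Nx.toNNReal * (My * dist a b) :=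
      (norm_inner_le_norm _ _).trans (mul_le_mul ((hNx b hb).trans
        (Real.le_coe_toNNReal _)) n2 (norm_nonneg _) (by positivity))
    calc _ ≤ ‖⟪x a - x b, y a⟫‖ + ‖⟪x b, y a - y b⟫‖ + ‖H a - H b‖ :=
          (norm_sub_le _ _).trans (by gcongr; exact norm_add_le _ _)
      _ ≤ _ := by push_cast; linarith
  have hder : ∀ᵐ t, t ∈ uIcc 0 T → HasDerivAt (fun t => ⟪X t, Y t⟫ - H t) 0 t := by
    filter_upwards [(intervalIntegrable_of_integrableOn_Icc hx.integrableOn h0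
        hT').ae_hasDerivAt_integral, (intervalIntegrable_of_integrableOn_Icc hy.integrableOn h0
        hT').ae_hasDerivAt_integral, (intervalIntegrable_of_integrableOn_Icc hint h0
        hT').ae_hasDerivAt_integral] with t h1 h2 h3 ht
    have k1 : HasDerivAt X (f t) t := (h1 ht 0 left_mem_uIcc).const_add _
    have k2 : HasDerivAt Y (g t) t := (h2 ht 0 left_mem_uIcc).const_add _
    have := (k1.inner ℝ k2).sub (h3 ht 0 left_mem_uIcc)
    rw [hu] at ht
    have hz : ⟪X t, g t⟫ + ⟪f t, Y t⟫ - h t = 0 := by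
      rw [hXx t ht, hYy t ht, hh]
      ring
    rwa [hz] at this
  obtain ⟨c, hc⟩ := hlip.absolutelyContinuousOnInterval.const_of_ae_hasDerivAt_zero hder
  rw [hu] at hc
  intro t ht
  have e1 := hc t ht
  have e2 := hc 0 h0
  simp only [hXx t ht, hYy t ht, hXx 0 h0, hYy 0 h0] at e1 e2
  have e3 : H 0 = 0 := by simp [hHdef]
  change _ = _ + H t
  linarith

end Hilbert

/-! ### Existence for linear Carathéodory equations. -/

/-- A linear Carathéodory equation with bounded measurable coefficients has a solution. -/
theorem exists_linear_integral_solution {V : Type*} [NormedAddCommGroup V] [NormedSpace ℝ V]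
    [CompleteSpace V] {T : ℝ} (hT : 0 ≤ T) {A : ℝ → V →L[ℝ] V}
    (hA : AEStronglyMeasurable A (volume.restrict (Icc 0 T))) {M : ℝ}
    (hM : ∀ t ∈ Icc 0 T, ‖A t‖ ≤ M) (x₀ : V) :
    ∃ x : ℝ → V, x 0 = x₀ ∧ IsBoundedPrimitive T x (fun t => A t (x t)) := by
  have h0 : (0 : ℝ) ∈ Icc 0 T := ⟨le_rfl, hT⟩
  have hM0 : 0 ≤ M := (norm_nonneg _).trans (hM 0 h0)
  -- Bielecki's weight: for the unknown `y t = exp (-l t) x t` the Picard map contracts by `M / l <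
  -- 1` in the sup norm on all of `[0, T]`, so no subdivision of the interval is needed.
  set l : ℝ := M + 1 with hl
  have hlpos : 0 < l := by positivity
  let F : C(Icc 0 T, V) → ℝ → V := fun y t => Real.exp (l * t) • A t (IccExtend hT y t)
  have hFmeas (y) : AEStronglyMeasurable (F y) (volume.restrict (Icc 0 T)) := by
    have hc : Continuous (IccExtend hT y) := y.continuous.Icc_extend'
    have he : Continuous fun t : ℝ => Real.exp (l * t) := by fun_prop
    exact he.aestronglyMeasurable.smul
      ((ContinuousLinearMap.id ℝ (V →L[ℝ] V)).aestronglyMeasurable_comp₂ hA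
        hc.aestronglyMeasurable)
  have hFbound (y) : ∀ t ∈ Icc 0 T, ‖F y t‖ ≤ Real.exp (l * T) * (M * ‖y‖) := by
    intro t ht
    rw [norm_smul, Real.norm_eq_abs, Real.abs_exp]
    refine mul_le_mul (Real.exp_le_exp.2 (by gcongr; exact ht.2)) ?_ (norm_nonneg _)
      (Real.exp_nonneg _)
    exact (A t).le_of_opNorm_le_of_le (hM t ht) (y.norm_coe_le_norm _)
  have hFint (y) : IntegrableOn (F y) (Icc 0 T) :=
    IntegrableOn.of_bound measure_Icc_lt_top (hFmeas y) _
      ((ae_restrict_iff' measurableSet_Icc).2 (Filter.Eventually.of_forall (hFbound y)))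
  let P : C(Icc 0 T, V) → ℝ → V := fun y t =>
    Real.exp (-(l * t)) • (x₀ + ∫ τ in (0 : ℝ)..t, F y τ)
  have hPcont (y) : ContinuousOn (P y) (Icc 0 T) := by
    have hu : uIcc 0 T = Icc 0 T := uIcc_of_le hT
    have := intervalIntegral.continuousOn_primitive_interval (hu.symm ▸ hFint y)
    rw [hu] at this
    refine ContinuousOn.smul (Continuous.continuousOn (by fun_prop)) (continuousOn_const.add this)
  let Φ : C(Icc 0 T, V) → C(Icc 0 T, V) := fun y =>
    ⟨(Icc 0 T).domRestrict (P y), (hPcont y).domRestrict⟩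
  have hΦ : ContractingWith (M / l).toNNReal Φ := by
    have hMl : 0 ≤ M / l := by positivity
    refine ⟨?_, LipschitzWith.of_dist_le_mul fun y z => ?_⟩
    · rw [Real.toNNReal_lt_one, div_lt_one hlpos]; linarith
    rw [Real.coe_toNNReal _ hMl, ContinuousMap.dist_le (by positivity)]
    rintro ⟨t, ht⟩
    change dist (P y t) (P z t) ≤ _
    have hiy := intervalIntegrable_of_integrableOn_Icc (hFint y) h0 ht
    have hiz := intervalIntegrable_of_integrableOn_Icc (hFint z) h0 ht
    have e1 : P y t - P z t = Real.exp (-(l * t)) • ∫ τ in (0 : ℝ)..t, (F y τ - F z τ) := by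
      rw [intervalIntegral.integral_sub hiy hiz, ← smul_sub, add_sub_add_left_eq_sub]
    have e2 : ‖∫ τ in (0 : ℝ)..t, (F y τ - F z τ)‖ ≤
        ∫ τ in (0 : ℝ)..t, Real.exp (l * τ) * (M * dist y z) := by
      refine intervalIntegral.norm_integral_le_of_norm_le ht.1
        (Filter.Eventually.of_forall fun τ hτ => ?_)
        (Continuous.intervalIntegrable (by fun_prop) _ _)
      have hτ' : τ ∈ Icc 0 T := ⟨hτ.1.le, hτ.2.trans ht.2⟩
      change ‖Real.exp (l * τ) • A τ _ - Real.exp (l * τ) • A τ _‖ ≤ _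
      rw [← smul_sub, ← map_sub, norm_smul, Real.norm_eq_abs, Real.abs_exp]
      refine mul_le_mul_of_nonneg_left ((A τ).le_of_opNorm_le_of_le (hM τ hτ') ?_)
        (Real.exp_nonneg _)
      rw [← dist_eq_norm]
      exact ContinuousMap.dist_apply_le_dist _
    have e3 : ∫ τ in (0 : ℝ)..t, Real.exp (l * τ) * (M * dist y z) =
        (Real.exp (l * t) - 1) / l * (M * dist y z) := by
      rw [intervalIntegral.integral_mul_const,
        intervalIntegral.integral_comp_mul_left (fun u => Real.exp u) hlpos.ne', integral_exp]
      simp [div_eq_inv_mul]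
    rw [dist_eq_norm, e1, norm_smul, Real.norm_eq_abs, Real.abs_exp]
    calc _ ≤ Real.exp (-(l * t)) * (Real.exp (l * t) / l * (M * dist y z)) := by
          refine mul_le_mul_of_nonneg_left (e2.trans ?_) (Real.exp_nonneg _)
          rw [e3]
          gcongr
          linarith
      _ = (Real.exp (-(l * t)) * Real.exp (l * t)) * (M / l * dist y z) := by ring
      _ = M / l * dist y z := by rw [← Real.exp_add]; simp
  obtain ⟨y, hy⟩ : ∃ y, Φ y = y := ⟨_, hΦ.fixedPoint_isFixedPt⟩
  have hyP : ∀ t ∈ Icc 0 T, IccExtend hT y t = P y t := by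
    intro t ht
    rw [IccExtend_of_mem hT y ht]
    conv_lhs => rw [← hy]
    rfl
  have hFy : ∀ t, F y t = A t (Real.exp (l * t) • IccExtend hT y t) := fun t => by
    rw [map_smul]
  have hx0 : Real.exp (l * 0) • IccExtend hT y 0 = x₀ := by
    rw [hyP 0 h0]; simp [P]
  refine ⟨fun t => Real.exp (l * t) • IccExtend hT y t, hx0, ?_⟩
  simp_rw [← hFy]
  refine ⟨hFint y, ⟨_, hFbound y⟩, fun t ht => ?_⟩
  rw [hx0, hyP t ht, smul_smul, ← Real.exp_add]
  simp

/-! ### Controls and control-affine linear equations. -/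

section Control

variable {V : Type*} [NormedAddCommGroup V] {T : ℝ} {s w : ℝ → ℝ}

theorem IsControl.lineMap (hs : IsControl T s) (hw : IsControl T w) {ε : ℝ}
    (hε : ε ∈ Icc (0 : ℝ) 1) : IsControl T (fun t => s t + ε * (w t - s t)) where
  measurable := hs.measurable.add ((hw.measurable.sub hs.measurable).const_mul ε)
  mem t ht := by
    obtain ⟨a, b⟩ := hs.mem t ht
    obtain ⟨c, d⟩ := hw.mem t ht
    obtain ⟨e, f⟩ := hε
    constructor <;> nlinarith

theorem IsControl.integrableOn (hs : IsControl T s) : IntegrableOn s (Icc 0 T) :=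
  IntegrableOn.of_bound measure_Icc_lt_top hs.measurable.aestronglyMeasurable 1
    ((ae_restrict_iff' measurableSet_Icc).2 (Filter.Eventually.of_forall fun t ht => by
      rw [Real.norm_eq_abs, abs_le]; constructor <;> linarith [(hs.mem t ht).1, (hs.mem t ht).2]))

theorem IsControl.integrableOn_bounded [NormedSpace ℝ V] (hs : IsControl T s) (A D : V →L[ℝ] V)
    {x : ℝ → V} (hx : ContinuousOn x (Icc 0 T)) :
    IntegrableOn (fun t => A (x t) + s t • D (x t)) (Icc 0 T) ∧
      ∃ M, ∀ t ∈ Icc 0 T, ‖A (x t) + s t • D (x t)‖ ≤ M := by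
  obtain ⟨N, hN⟩ := isCompact_Icc.exists_bound_of_continuousOn hx
  have hb : ∀ t ∈ Icc 0 T, ‖A (x t) + s t • D (x t)‖ ≤ ‖A‖ * N + 1 * (‖D‖ * N) := by
    intro t ht
    refine (norm_add_le _ _).trans (add_le_add (A.le_opNorm_of_le (hN t ht)) ?_)
    rw [norm_smul]
    refine mul_le_mul ?_ (D.le_opNorm_of_le (hN t ht)) (norm_nonneg _) zero_le_one
    rw [Real.norm_eq_abs, abs_le]
    constructor <;> linarith [(hs.mem t ht).1, (hs.mem t ht).2]
  refine ⟨IntegrableOn.of_bound measure_Icc_lt_top ?_ _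
      ((ae_restrict_iff' measurableSet_Icc).2 (Filter.Eventually.of_forall hb)), ⟨_, hb⟩⟩
  exact ((A.continuous.comp_continuousOn hx).aestronglyMeasurable measurableSet_Icc).add
    (hs.measurable.aestronglyMeasurable.smul
      ((D.continuous.comp_continuousOn hx).aestronglyMeasurable measurableSet_Icc))

theorem exists_controlled_solution [NormedSpace ℝ V] [CompleteSpace V] (hT : 0 ≤ T)
    (hs : IsControl T s) (A D : V →L[ℝ] V) (x₀ : V) :
    ∃ x : ℝ → V, x 0 = x₀ ∧ IsBoundedPrimitive T x (fun t => A (x t) + s t • D (x t)) := by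
  refine exists_linear_integral_solution (A := fun t => A + s t • D) (M := ‖A‖ + 1 * ‖D‖) hT
    (aestronglyMeasurable_const.add (hs.measurable.aestronglyMeasurable.smul_const D))
    (fun t ht => ?_) x₀
  refine (norm_add_le _ _).trans ?_
  rw [norm_smul]
  gcongr
  rw [Real.norm_eq_abs, abs_le]
  constructor <;> linarith [(hs.mem t ht).1, (hs.mem t ht).2]

theorem exists_controlled_solution_terminal [NormedSpace ℝ V] [CompleteSpace V] (hT : 0 ≤ T)
    (hs : IsControl T s) (A D : V →L[ℝ] V) (x₁ : V) :
    ∃ x : ℝ → V, x T = x₁ ∧ IsBoundedPrimitive T x (fun t => A (x t) + s t • D (x t)) := by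
  have hr : IsControl T (fun t => s (T - t)) := by
    refine ⟨?_, fun t ht => hs.mem _ ⟨by linarith [ht.2], by linarith [ht.1]⟩⟩
    -- Measurability of the reflected control is read off from integrability, which the substitution
    -- t ↦ T - t preserves.
    have h1 := (intervalIntegrable_iff_integrableOn_Icc_of_le hT).2 hs.integrableOn
    have h2 := (h1.comp_sub_left T).symm
    simp only [sub_self, sub_zero] at h2
    exact ((intervalIntegrable_iff_integrableOn_Icc_of_le hT).1 h2).aestronglyMeasurable.aemeasurable
  obtain ⟨x, hx0, hx⟩ := exists_controlled_solution hT hr (-A) (-D) x₁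
  refine ⟨fun t => x (T - t), by simpa using hx0, (hx.reverse hT).congr fun t _ => ?_⟩
  simp [add_comm]

end Control

/-! ### Skew generators and the maximum principle. -/

section Skew

variable {V : Type*} [NormedAddCommGroup V] [InnerProductSpace ℝ V] [CompleteSpace V]
  {T : ℝ} {s r : ℝ → ℝ} {A D : V →L[ℝ] V} {x y : ℝ → V}

/-- Along two solutions with skew-adjoint generators only the difference of the controls changes
the scalar product. -/
theorem IsBoundedPrimitive.inner_skew (hT : 0 ≤ T) (hA : ∀ u v, ⟪A u, v⟫ = -⟪u, A v⟫)
    (hD : ∀ u v, ⟪D u, v⟫ = -⟪u, D v⟫)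
    (hx : IsBoundedPrimitive T x (fun t => A (x t) + s t • D (x t)))
    (hy : IsBoundedPrimitive T y (fun t => A (y t) + r t • D (y t))) :
    IsBoundedPrimitive T (fun t => ⟪x t, y t⟫) (fun t => (r t - s t) * ⟪x t, D (y t)⟫) := by
  refine (hx.inner hT hy).congr fun t _ => ?_
  rw [inner_add_left, inner_add_right, real_inner_smul_left, real_inner_smul_right, hA, hD]
  ring

theorem inner_eq_of_skew (hA : ∀ u v, ⟪A u, v⟫ = -⟪u, A v⟫)
    (hD : ∀ u v, ⟪D u, v⟫ = -⟪u, D v⟫)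
    (hx : IsBoundedPrimitive T x (fun t => A (x t) + s t • D (x t)))
    (hy : IsBoundedPrimitive T y (fun t => A (y t) + s t • D (y t)))
    {a b : ℝ} (ha : a ∈ Icc 0 T) (hb : b ∈ Icc 0 T) : ⟪x a, y a⟫ = ⟪x b, y b⟫ := by
  have := (hx.inner_skew (ha.1.trans ha.2) hA hD hy).eq_add_integral ha hb
  simpa using this.symm

/-- Conservation of the norm replaces Grönwall estimates, and also gives uniqueness and the
nonvanishing of co-states. -/
theorem norm_eq_of_skew (hA : ∀ u v, ⟪A u, v⟫ = -⟪u, A v⟫)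
    (hD : ∀ u v, ⟪D u, v⟫ = -⟪u, D v⟫)
    (hx : IsBoundedPrimitive T x (fun t => A (x t) + s t • D (x t)))
    {a b : ℝ} (ha : a ∈ Icc 0 T) (hb : b ∈ Icc 0 T) : ‖x a‖ = ‖x b‖ := by
  have := inner_eq_of_skew hA hD hx hx ha hb
  rw [real_inner_self_eq_norm_sq, real_inner_self_eq_norm_sq] at this
  exact (sq_eq_sq₀ (norm_nonneg _) (norm_nonneg _)).1 this

/-- Solutions with the same initial value for two controls at distance at most `ε`. -/
theorem norm_sub_sq_le_of_skew (hA : ∀ u v, ⟪A u, v⟫ = -⟪u, A v⟫)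
    (hD : ∀ u v, ⟪D u, v⟫ = -⟪u, D v⟫)
    (hx : IsBoundedPrimitive T x (fun t => A (x t) + s t • D (x t)))
    (hy : IsBoundedPrimitive T y (fun t => A (y t) + r t • D (y t))) (h0 : x 0 = y 0)
    {ε : ℝ} (hε : ∀ t ∈ Icc 0 T, |r t - s t| ≤ ε) {t : ℝ} (ht : t ∈ Icc 0 T) :
    ‖y t - x t‖ ^ 2 ≤ 2 * (ε * (‖x 0‖ * (‖D‖ * ‖x 0‖)) * T) := by
  have hz : (0 : ℝ) ∈ Icc 0 T := ⟨le_rfl, ht.1.trans ht.2⟩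
  have hxn : ∀ τ ∈ Icc 0 T, ‖x τ‖ = ‖x 0‖ := fun τ hτ => norm_eq_of_skew hA hD hx hτ hz
  have hyn : ∀ τ ∈ Icc 0 T, ‖y τ‖ = ‖x 0‖ := fun τ hτ => by
    rw [norm_eq_of_skew hA hD hy hτ hz, h0]
  have e := (hx.inner_skew hz.2 hA hD hy).eq t ht
  have hε0 : 0 ≤ ε := (abs_nonneg _).trans (hε t ht)
  have hb : ‖∫ τ in (0 : ℝ)..t, (r τ - s τ) * ⟪x τ, D (y τ)⟫‖ ≤
      ε * (‖x 0‖ * (‖D‖ * ‖x 0‖)) * |t - 0| := by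
    refine intervalIntegral.norm_integral_le_of_norm_le_const fun τ hτ => ?_
    have hτ' : τ ∈ Icc 0 T := ordConnected_Icc.uIcc_subset hz ht (uIoc_subset_uIcc hτ)
    rw [norm_mul]
    refine mul_le_mul (hε τ hτ') ((norm_inner_le_norm _ _).trans ?_) (norm_nonneg _) hε0
    rw [hxn τ hτ']
    gcongr
    exact D.le_opNorm_of_le (hyn τ hτ').le
  -- Both norms equal `‖x 0‖` and ⟪x, y⟫ = ‖x 0‖² + O(ε), so ‖y - x‖² = O(ε). The resulting rate √ε
  -- suffices for the limit.
  rw [@norm_sub_sq_real, hyn t ht, hxn t ht, real_inner_comm, e, ← h0, real_inner_self_eq_norm_sq]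
  have hb' := (abs_le.1 hb).1
  rw [sub_zero, abs_of_nonneg ht.1] at hb'
  have : ε * (‖x 0‖ * (‖D‖ * ‖x 0‖)) * t ≤ ε * (‖x 0‖ * (‖D‖ * ‖x 0‖)) * T := by
    gcongr; exact ht.2
  linarith

variable {p : ℝ → V} {q x₀ : V}

/-- First order optimality condition: the first variation of the final cost `⟪q, x(T)⟫` in the
direction of another control has a sign. -/
theorem integral_variation_nonpos (hT : 0 ≤ T) (hA : ∀ u v, ⟪A u, v⟫ = -⟪u, A v⟫)
    (hD : ∀ u v, ⟪D u, v⟫ = -⟪u, D v⟫) (hs : IsControl T s) (hx0 : x 0 = x₀)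
    (hx : IsBoundedPrimitive T x (fun t => A (x t) + s t • D (x t)))
    (hp : IsBoundedPrimitive T p (fun t => A (p t) + s t • D (p t))) (hpT : p T = -q)
    (hopt : ∀ r y, IsControl T r → y 0 = x₀ →
      IsBoundedPrimitive T y (fun t => A (y t) + r t • D (y t)) → ⟪q, x T⟫ ≤ ⟪q, y T⟫)
    {w : ℝ → ℝ} (hw : IsControl T w) :
    ∫ t in (0 : ℝ)..T, (w t - s t) * ⟪p t, D (x t)⟫ ≤ 0 := by
  have hz : (0 : ℝ) ∈ Icc 0 T := ⟨le_rfl, hT⟩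
  have hTm : T ∈ Icc 0 T := ⟨hT, le_rfl⟩
  set C : ℝ := 2 * ((‖x 0‖ * (‖D‖ * ‖x 0‖)) * T) with hC
  -- Optimality gives the sign of the integral along the perturbed trajectory `y`; the right-hand
  -- side bounds the cost of replacing `y` by `x`.
  have key : ∀ ε ∈ Ioc (0 : ℝ) 1, ∫ t in (0 : ℝ)..T, (w t - s t) * ⟪p t, D (x t)⟫ ≤
      ‖p 0‖ * (‖D‖ * √(ε * C)) * T := by
    intro ε hε
    have hr := hs.lineMap hw ⟨hε.1.le, hε.2⟩
    obtain ⟨y, hy0, hy⟩ := exists_controlled_solution hT hr A D x₀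
    have hle := hopt _ y hr hy0 hy
    -- Together these give the exact increment ⟪q, y T⟫ = ⟪q, x T⟫ - ε ∫ (w - s)⟪p, D y⟫.
    have e1 := (hp.inner_skew hT hA hD hy).eq T hTm
    have e2 := inner_eq_of_skew hA hD hp hx hTm hz
    simp only [add_sub_cancel_left, hpT, inner_neg_left, mul_assoc] at e1 e2
    rw [intervalIntegral.integral_const_mul, hy0, ← hx0, ← e2] at e1
    have h1 : ∫ t in (0 : ℝ)..T, (w t - s t) * ⟪p t, D (y t)⟫ ≤ 0 := by
      by_contra! hneg
      have := mul_pos hε.1 hneg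
      linarith
    have hint : ∀ {z : ℝ → V}, ContinuousOn z (Icc 0 T) →
        IntervalIntegrable (fun t => (w t - s t) * ⟪p t, D (z t)⟫) volume 0 T := by
      intro z hzc
      refine intervalIntegrable_of_integrableOn_Icc ?_ hz hTm
      refine (hw.integrableOn.sub hs.integrableOn).mul_continuousOn ?_ isCompact_Icc
      exact hp.continuousOn.inner (D.continuous.comp_continuousOn hzc)
    have h2 : ‖∫ t in (0 : ℝ)..T, ((w t - s t) * ⟪p t, D (x t)⟫ -
        (w t - s t) * ⟪p t, D (y t)⟫)‖ ≤ ‖p 0‖ * (‖D‖ * √(ε * C)) * |T - 0| := by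
      refine intervalIntegral.norm_integral_le_of_norm_le_const fun t ht => ?_
      have ht' : t ∈ Icc 0 T := ordConnected_Icc.uIcc_subset hz hTm (uIoc_subset_uIcc ht)
      obtain ⟨a, b⟩ := hs.mem t ht'
      obtain ⟨c, d⟩ := hw.mem t ht'
      rw [← mul_sub, ← inner_sub_right, ← map_sub, norm_mul]
      have k1 : ‖w t - s t‖ ≤ 1 := by
        rw [Real.norm_eq_abs, abs_le]; constructor <;> linarith
      have k2 : ‖x t - y t‖ ≤ √(ε * C) := by
        refine Real.le_sqrt_of_sq_le ?_
        rw [norm_sub_rev]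
        refine (norm_sub_sq_le_of_skew hA hD hx hy (hx0.trans hy0.symm) (ε := ε)
          (fun τ hτ => ?_) ht').trans (le_of_eq (by rw [hC]; ring))
        obtain ⟨a, b⟩ := hs.mem τ hτ
        obtain ⟨c, d⟩ := hw.mem τ hτ
        rw [add_sub_cancel_left, abs_mul, abs_of_pos hε.1]
        refine mul_le_of_le_one_right hε.1.le ?_
        rw [abs_le]; constructor <;> linarith
      calc _ ≤ 1 * ‖⟪p t, D (x t - y t)⟫‖ := by gcongr
        _ ≤ ‖p t‖ * ‖D (x t - y t)‖ := by rw [one_mul]; exact norm_inner_le_norm _ _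
        _ ≤ _ := by
          rw [norm_eq_of_skew hA hD hp ht' hz]
          gcongr
          exact D.le_opNorm_of_le k2
    rw [intervalIntegral.integral_sub (hint hx.continuousOn) (hint hy.continuousOn), sub_zero,
      abs_of_nonneg hT] at h2
    have := (abs_le.1 h2).2
    linarith
  have hlim : Filter.Tendsto (fun ε : ℝ => ‖p 0‖ * (‖D‖ * √(ε * C)) * T) (𝓝[>] 0) (𝓝 0) := by
    have : Continuous fun ε : ℝ => ‖p 0‖ * (‖D‖ * √(ε * C)) * T := by fun_prop
    have h := this.tendsto 0
    simp only [zero_mul, Real.sqrt_zero, mul_zero] at h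
    exact h.mono_left nhdsWithin_le_nhds
  refine ge_of_tendsto hlim ?_
  filter_upwards [Ioc_mem_nhdsGT zero_lt_one] with ε hε using key ε hε

/-- Pontryagin's maximum principle for the fixed-time linear-cost problem of a skew-adjoint
control-affine linear system. -/
theorem bang_of_optimal (hT : 0 ≤ T) (hA : ∀ u v, ⟪A u, v⟫ = -⟪u, A v⟫)
    (hD : ∀ u v, ⟪D u, v⟫ = -⟪u, D v⟫) (hs : IsControl T s) (hx0 : x 0 = x₀)
    (hx : IsBoundedPrimitive T x (fun t => A (x t) + s t • D (x t)))
    (hp : IsBoundedPrimitive T p (fun t => A (p t) + s t • D (p t))) (hpT : p T = -q)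
    (hopt : ∀ r y, IsControl T r → y 0 = x₀ →
      IsBoundedPrimitive T y (fun t => A (y t) + r t • D (y t)) → ⟪q, x T⟫ ≤ ⟪q, y T⟫) :
    ∀ᵐ t ∂(volume.restrict (Icc 0 T)),
      (⟪p t, D (x t)⟫ < 0 → s t = 0) ∧ (0 < ⟪p t, D (x t)⟫ → s t = 1) := by
  have hz : (0 : ℝ) ∈ Icc 0 T := ⟨le_rfl, hT⟩
  have hTm : T ∈ Icc 0 T := ⟨hT, le_rfl⟩
  set φ : ℝ → ℝ := fun t => ⟪p t, D (x t)⟫ with hφ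
  have hφc : ContinuousOn φ (Icc 0 T) :=
    hp.continuousOn.inner (D.continuous.comp_continuousOn hx.continuousOn)
  -- A continuous extension to the line makes the sign sets measurable.
  obtain ⟨ψ, hψc, hψ⟩ : ∃ ψ : ℝ → ℝ, Continuous ψ ∧ ∀ t ∈ Icc 0 T, ψ t = φ t :=
    ⟨IccExtend hT ((Icc 0 T).domRestrict φ), hφc.domRestrict.Icc_extend',
      fun t ht => IccExtend_of_mem hT _ ht⟩
  classical
  -- The pointwise maximizer of v ↦ v φ(t) on `[0, 1]`; where φ = 0 every value maximizes, and `s`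
  -- is kept.
  set w : ℝ → ℝ := fun t => if ψ t < 0 then 0 else if 0 < ψ t then 1 else s t with hwdef
  have hw : IsControl T w := by
    obtain ⟨σ, hσ, hσs⟩ := hs.measurable
    refine ⟨⟨fun t => if ψ t < 0 then 0 else if 0 < ψ t then 1 else σ t, ?_, ?_⟩, ?_⟩
    · exact Measurable.ite (hψc.measurable measurableSet_Iio) measurable_const
        (Measurable.ite (hψc.measurable measurableSet_Ioi) measurable_const hσ)
    · filter_upwards [hσs] with t ht
      simp [hwdef, ht]
    · intro t ht
      simp only [hwdef]
      split_ifs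
      · simp
      · simp
      · exact hs.mem t ht
  have hle := integral_variation_nonpos hT hA hD hs hx0 hx hp hpT hopt hw
  have hint : IntegrableOn (fun t => (w t - s t) * φ t) (Icc 0 T) :=
    (hw.integrableOn.sub hs.integrableOn).mul_continuousOn hφc isCompact_Icc
  have hnn : ∀ t ∈ Icc 0 T, 0 ≤ (w t - s t) * φ t := by
    intro t ht
    obtain ⟨a, b⟩ := hs.mem t ht
    simp only [hwdef]
    rw [hψ t ht]
    split_ifs with h1 h2
    · nlinarith
    · nlinarith
    · simp
  rw [intervalIntegral.integral_of_le hT, ← integral_Icc_eq_integral_Ioc] at hle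
  have hnn' : 0 ≤ᵐ[volume.restrict (Icc 0 T)] fun t => (w t - s t) * φ t :=
    (ae_restrict_iff' measurableSet_Icc).2 (Filter.Eventually.of_forall hnn)
  have hzero := (integral_eq_zero_iff_of_nonneg_ae hnn' hint).1
    (le_antisymm hle (integral_nonneg_of_ae hnn'))
  filter_upwards [hzero, ae_restrict_mem measurableSet_Icc] with t h0 ht
  simp only [hwdef, Pi.zero_apply, mul_eq_zero, hψ t ht] at h0
  refine ⟨fun hneg => ?_, fun hpos => ?_⟩
  · rw [if_pos hneg] at h0
    rcases h0 with h | h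
    · linarith
    · exact absurd h hneg.ne
  · rw [if_neg hpos.le.not_gt, if_pos hpos] at h0
    rcases h0 with h | h
    · linarith
    · exact absurd h hpos.ne'

end Skew

/-! ### Maximal arcs and the sign of a continuous function. -/

/-- The maximal arcs of `[0, T]` on which `Q` holds. -/
def maximalArcs (T : ℝ) (Q : ℝ → Prop) : Set (Set ℝ) :=
  {I | Maximal (fun I => OpenSystem.IsArc T I ∧ ∀ t ∈ I, Q t) I}

theorem maximalArcs_congr {T : ℝ} {Q R : ℝ → Prop} (h : ∀ t ∈ Icc 0 T, (Q t ↔ R t)) :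
    maximalArcs T Q = maximalArcs T R := by
  have : (fun I => OpenSystem.IsArc T I ∧ ∀ t ∈ I, Q t) =
      fun I => OpenSystem.IsArc T I ∧ ∀ t ∈ I, R t := by
    ext I
    exact and_congr_right fun hI => forall₂_congr fun t ht => h t (hI.1 ht)
  rw [maximalArcs, this, maximalArcs]

/-- Gives countability: disjoint subsets of the line with nonempty interior are countably many. -/
theorem OpenSystem.IsArc.interior_nonempty {T : ℝ} {I : Set ℝ} (hI : OpenSystem.IsArc T I) :
    (interior I).Nonempty := by
  obtain ⟨x, hx, y, hy, hxy⟩ := hI.2.2.exists_lt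
  obtain ⟨z, hz⟩ := exists_between hxy
  have hsub : Ioo x y ⊆ I := Ioo_subset_Icc_self.trans (hI.2.1.out hx hy)
  exact ⟨z, interior_maximal hsub isOpen_Ioo hz⟩

/-- The union of two intervals with a common point is an interval, so maximality forces both to
equal the union. -/
theorem maximalArcs_eq_of_mem {T : ℝ} {Q : ℝ → Prop} {I J : Set ℝ} (hI : I ∈ maximalArcs T Q)
    (hJ : J ∈ maximalArcs T Q) {t : ℝ} (htI : t ∈ I) (htJ : t ∈ J) : I = J := by
  obtain ⟨⟨⟨hIs, hIo, hIn⟩, hIQ⟩, -⟩ := id hI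
  obtain ⟨⟨⟨hJs, hJo, hJn⟩, hJQ⟩, -⟩ := id hJ
  have hU : OpenSystem.IsArc T (I ∪ J) ∧ ∀ t ∈ I ∪ J, Q t := by
    refine ⟨⟨union_subset hIs hJs, ?_, hIn.mono subset_union_left⟩, ?_⟩
    · exact (hIo.isPreconnected.union t htI htJ hJo.isPreconnected).ordConnected
    · rintro u (hu | hu)
      exacts [hIQ u hu, hJQ u hu]
  rw [maximalArcs, mem_ofPred_eq] at hI hJ
  exact (hI.eq_of_subset hU subset_union_left).trans
    (hJ.eq_of_subset hU subset_union_right).symm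

/-- The maximal arc is the order-connected component of `t` in the set where `Q` holds; it is
nondegenerate because it contains `I`. -/
theorem exists_mem_maximalArcs {T : ℝ} {Q : ℝ → Prop} {I : Set ℝ} (hI : OpenSystem.IsArc T I)
    (hQ : ∀ t ∈ I, Q t) {t : ℝ} (ht : t ∈ I) : ∃ J ∈ maximalArcs T Q, t ∈ J := by
  set A : Set ℝ := {t ∈ Icc 0 T | Q t} with hA
  have hsub : ∀ {J : Set ℝ}, OpenSystem.IsArc T J → (∀ t ∈ J, Q t) → t ∈ J →
      J ⊆ ordConnectedComponent A t := fun hJ hJQ htJ =>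
    haveI := hJ.2.1
    subset_ordConnectedComponent htJ fun u hu => ⟨hJ.1 hu, hJQ u hu⟩
  have hcA : ordConnectedComponent A t ⊆ A := ordConnectedComponent_subset
  refine ⟨ordConnectedComponent A t, ⟨⟨⟨fun u hu => (hcA hu).1, inferInstance,
    hI.2.2.mono (hsub hI hQ ht)⟩, fun u hu => (hcA hu).2⟩, ?_⟩, hsub hI hQ ht ht⟩
  intro J hJ hle
  exact hsub hJ.1 hJ.2 (hle (hsub hI hQ ht ht))

theorem sUnion_maximalArcs_of_isOpen {T : ℝ} (hT : 0 < T) {U : Set ℝ} (hU : IsOpen U) :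
    ⋃₀ maximalArcs T (· ∈ U) = {t ∈ Icc 0 T | t ∈ U} := by
  ext t
  constructor
  · rintro ⟨I, hI, ht⟩
    exact ⟨hI.1.1.1 ht, hI.1.2 t ht⟩
  · rintro ⟨ht, htU⟩
    obtain ⟨ε, hε, hb⟩ := Metric.isOpen_iff.1 hU t htU
    rw [Real.ball_eq_Ioo] at hb
    have htI : t ∈ Icc 0 T ∩ Ioo (t - ε) (t + ε) := ⟨ht, by linarith, by linarith⟩
    have harc : OpenSystem.IsArc T (Icc 0 T ∩ Ioo (t - ε) (t + ε)) := by
      refine ⟨inter_subset_left, ordConnected_Icc.inter ordConnected_Ioo, ?_⟩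
      -- A second point of the relative neighbourhood is found to the right of `t`, or to the left
      -- if `t = T`.
      rcases ht.2.lt_or_eq with h | h
      · refine ⟨t, htI, min T (t + ε / 2), ⟨⟨?_, min_le_left _ _⟩, ?_, ?_⟩, ?_⟩
        · exact le_min hT.le (by linarith [ht.1])
        · exact lt_min (by linarith) (by linarith)
        · exact (min_le_right _ _).trans_lt (by linarith)
        · exact (lt_min h (by linarith)).ne
      · refine ⟨t, htI, max 0 (t - ε / 2), ⟨⟨le_max_left _ _, ?_⟩, ?_, ?_⟩, ?_⟩
        · exact max_le hT.le (by linarith [ht.2])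
        · exact lt_of_lt_of_le (by linarith) (le_max_right _ _)
        · exact max_lt (by linarith) (by linarith)
        · exact (max_lt (by linarith) (by linarith)).ne'
    obtain ⟨J, hJ, htJ⟩ := exists_mem_maximalArcs harc (fun u hu => hb hu.2) htI
    exact ⟨J, hJ, htJ⟩

/-- The sign of a continuous function decomposes an interval into maximal arcs. -/
theorem alternation_of_continuousOn {T : ℝ} (hT : 0 < T) {φ : ℝ → ℝ}
    (hφ : ContinuousOn φ (Icc 0 T)) :
    let N := maximalArcs T (fun t => φ t < 0)
    let P := maximalArcs T (fun t => 0 < φ t)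
    let Z := maximalArcs T (fun t => φ t = 0)
    (N ∪ P ∪ Z).Countable ∧ (N ∪ P ∪ Z).PairwiseDisjoint id ∧
      ⋃₀ N = {t ∈ Icc 0 T | φ t < 0} ∧ ⋃₀ P = {t ∈ Icc 0 T | 0 < φ t} ∧
      IsNowhereDense (Icc 0 T \ ⋃₀ (N ∪ P ∪ Z)) := by
  intro N P Z
  obtain ⟨ψ, hψc, hψ⟩ : ∃ ψ : ℝ → ℝ, Continuous ψ ∧ ∀ t ∈ Icc 0 T, ψ t = φ t :=
    ⟨IccExtend hT.le ((Icc 0 T).domRestrict φ), hφ.domRestrict.Icc_extend',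
      fun t ht => IccExtend_of_mem hT.le _ ht⟩
  have hN : ⋃₀ N = {t ∈ Icc 0 T | φ t < 0} := by
    have h : N = maximalArcs T (· ∈ {t | ψ t < 0}) :=
      maximalArcs_congr fun t ht => by simp [hψ t ht]
    rw [h, sUnion_maximalArcs_of_isOpen hT (isOpen_lt hψc continuous_const)]
    ext t
    exact and_congr_right fun ht => by simp [hψ t ht]
  have hP : ⋃₀ P = {t ∈ Icc 0 T | 0 < φ t} := by
    have h : P = maximalArcs T (· ∈ {t | 0 < ψ t}) :=
      maximalArcs_congr fun t ht => by simp [hψ t ht]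
    rw [h, sUnion_maximalArcs_of_isOpen hT (isOpen_lt continuous_const hψc)]
    ext t
    exact and_congr_right fun ht => by simp [hψ t ht]
  have hdisj : (N ∪ P ∪ Z).PairwiseDisjoint id := by
    intro I hI J hJ hne
    refine Set.disjoint_left.2 fun t htI htJ => hne ?_
    rcases hI with (hI | hI) | hI <;> rcases hJ with (hJ | hJ) | hJ
    all_goals
      first
      | exact maximalArcs_eq_of_mem hI hJ htI htJ
      | have h1 := hI.1.2 t htI
        have h2 := hJ.1.2 t htJ
        simp only at h1 h2
        linarith
  refine ⟨hdisj.countable_of_nonempty_interior ?_, hdisj, hN, hP, ?_⟩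
  · rintro I ((hI | hI) | hI) <;> exact hI.1.1.interior_nonempty
  · set R : Set ℝ := Icc 0 T \ ⋃₀ (N ∪ P ∪ Z) with hR
    have hRZ : R ⊆ {t ∈ Icc 0 T | φ t = 0} := by
      rintro t ⟨ht, hnt⟩
      rw [sUnion_union, sUnion_union, hN, hP] at hnt
      refine ⟨ht, ?_⟩
      by_contra hne
      rcases lt_or_gt_of_ne hne with h | h
      · exact hnt (Or.inl (Or.inl ⟨ht, h⟩))
      · exact hnt (Or.inl (Or.inr ⟨ht, h⟩))
    have hclosed : IsClosed {t ∈ Icc 0 T | φ t = 0} := by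
      have : {t ∈ Icc 0 T | φ t = 0} = Icc 0 T ∩ {t | ψ t = 0} := by
        ext t
        exact and_congr_right fun ht => by simp [hψ t ht]
      rw [this]
      exact isClosed_Icc.inter (isClosed_eq hψc continuous_const)
    -- The zero set is closed, so an interval inside `closure R` would lie in a maximal zero arc;
    -- yet it meets `R`, which avoids all such arcs.
    have hclR : closure R ⊆ {t ∈ Icc 0 T | φ t = 0} := closure_minimal hRZ hclosed
    rw [IsNowhereDense, eq_empty_iff_forall_notMem]
    intro t ht
    obtain ⟨ε, hε, hb⟩ := Metric.isOpen_iff.1 isOpen_interior t ht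
    rw [Real.ball_eq_Ioo] at hb
    have hbZ : Ioo (t - ε) (t + ε) ⊆ {t ∈ Icc 0 T | φ t = 0} :=
      (hb.trans interior_subset).trans hclR
    obtain ⟨u, hu, huR⟩ := mem_closure_iff.1 (interior_subset ht) (Ioo (t - ε) (t + ε)) isOpen_Ioo
      ⟨by linarith, by linarith⟩
    obtain ⟨J, hJ, huJ⟩ := exists_mem_maximalArcs (T := T) (Q := fun t => φ t = 0)
      (I := Ioo (t - ε) (t + ε)) ⟨fun v hv => (hbZ hv).1, ordConnected_Ioo,
        ⟨t, ⟨by linarith, by linarith⟩, t + ε / 2, ⟨by linarith, by linarith⟩, by linarith⟩⟩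
      (fun v hv => (hbZ hv).2) hu
    exact huR.2 ⟨J, Or.inr hJ, huJ⟩

noncomputable section

/-! ### Matrices as vectors; the superoperators `K X`. -/

section Vectorization

variable {n : Type*} [Fintype n]

/-- Matrices as vectors of a Euclidean space. -/
def vec (n : Type*) [Fintype n] : Matrix n n ℂ ≃L[ℝ] EuclideanSpace ℂ (n × n) :=
  LinearEquiv.toContinuousLinearEquiv
    { toFun := fun M => WithLp.toLp 2 fun ij => M ij.1 ij.2
      invFun := fun v => Matrix.of fun i j => v (i, j)
      map_add' := fun _ _ => rfl
      map_smul' := fun _ _ => rfl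
      left_inv := fun _ => rfl
      right_inv := fun _ => rfl }

theorem vec_apply (M : Matrix n n ℂ) (i j : n) : vec n M (i, j) = M i j := rfl

/-- Real scalars are used since the conjugate transpose is only real-linear. -/
theorem inner_vec (X Y : Matrix n n ℂ) : ⟪vec n X, vec n Y⟫ = (hsInner X Y).re := by
  rw [PiLp.inner_apply, Fintype.sum_prod_type, Finset.sum_comm, hsInner, Matrix.trace,
    Complex.re_sum]
  refine Finset.sum_congr rfl fun j _ => ?_
  rw [Matrix.diag_apply, Matrix.mul_apply, Complex.re_sum]
  refine Finset.sum_congr rfl fun i _ => ?_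
  rw [vec_apply, vec_apply, Complex.inner, Matrix.conjTranspose_apply, Complex.star_def,
    mul_comm]

theorem hsInner_add_right (X Y Z : Matrix n n ℂ) :
    hsInner X (Y + Z) = hsInner X Y + hsInner X Z := by
  simp [hsInner, Matrix.mul_add]

theorem hsInner_sub_right (X Y Z : Matrix n n ℂ) :
    hsInner X (Y - Z) = hsInner X Y - hsInner X Z := by
  simp [hsInner, Matrix.mul_sub]

theorem hsInner_smul_right (c : ℂ) (X Y : Matrix n n ℂ) :
    hsInner X (c • Y) = c * hsInner X Y := by
  simp [hsInner]

theorem hsInner_im_eq_zero {X Y : Matrix n n ℂ} (hX : X.IsHermitian) (hY : Y.IsHermitian) :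
    (hsInner X Y).im = 0 := by
  rw [← Complex.conj_eq_iff_im, ← Complex.star_def, hsInner, ← Matrix.trace_conjTranspose,
    Matrix.conjTranspose_mul, Matrix.conjTranspose_conjTranspose, hX.eq, hY.eq,
    Matrix.trace_mul_comm]

theorem eq_zero_of_hsInner_self {X : Matrix n n ℂ} (h : hsInner X X = 0) : X = 0 := by
  have : ⟪vec n X, vec n X⟫ = 0 := by rw [inner_vec, h, Complex.zero_re]
  simpa using this

/-- A real-linear map between matrices in vectorized form. -/
def vecMap (F : Matrix n n ℂ →ₗ[ℝ] Matrix n n ℂ) :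
    EuclideanSpace ℂ (n × n) →L[ℝ] EuclideanSpace ℂ (n × n) :=
  LinearMap.toContinuousLinearMap
    ((vec n).toLinearEquiv.toLinearMap ∘ₗ F ∘ₗ (vec n).symm.toLinearEquiv.toLinearMap)

theorem vecMap_vec (F : Matrix n n ℂ →ₗ[ℝ] Matrix n n ℂ) (X : Matrix n n ℂ) :
    vecMap F (vec n X) = vec n (F X) := by
  simp [vecMap]

variable [DecidableEq n]

theorem K_add (X X' Y : Matrix n n ℂ) : K (X + X') Y = K X Y + K X' Y := by
  simp only [K_apply, Matrix.add_mul, Matrix.mul_add, ← smul_add]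
  congr 1
  abel

theorem K_sub (X X' Y : Matrix n n ℂ) : K (X - X') Y = K X Y - K X' Y := by
  simp only [K_apply, Matrix.sub_mul, Matrix.mul_sub, ← smul_sub]
  congr 1
  abel

theorem K_smul (c : ℂ) (X Y : Matrix n n ℂ) : K (c • X) Y = c • K X Y := by
  simp only [K_apply, Matrix.smul_mul, Matrix.mul_smul, ← smul_sub, smul_comm c]

theorem conjTranspose_K {X : Matrix n n ℂ} (hX : X.IsHermitian) (Y : Matrix n n ℂ) :
    (K X Y).conjTranspose = K X Y.conjTranspose := by
  rw [K_apply, K_apply, Matrix.conjTranspose_smul, Matrix.conjTranspose_sub,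
    Matrix.conjTranspose_mul, Matrix.conjTranspose_mul, hX.eq, star_neg, Complex.star_def,
    Complex.conj_I, neg_smul, ← smul_neg, neg_sub]

/-- `K X` commutes with †, and cyclicity of the trace moves the commutator to the other factor with
a sign. -/
theorem hsInner_K_left {X : Matrix n n ℂ} (hX : X.IsHermitian) (Y Z : Matrix n n ℂ) :
    hsInner (K X Y) Z = -hsInner Y (K X Z) := by
  rw [hsInner, hsInner, conjTranspose_K hX, K_apply, K_apply, Matrix.smul_mul, Matrix.mul_smul,
    Matrix.trace_smul, Matrix.trace_smul, Matrix.sub_mul, Matrix.mul_sub, Matrix.trace_sub,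
    Matrix.trace_sub, Matrix.mul_assoc X, Matrix.trace_mul_comm X, ← Matrix.mul_assoc,
    ← Matrix.mul_assoc, smul_eq_mul, smul_eq_mul]
  ring

theorem hsAdjoint_K {X : Matrix n n ℂ} (hX : X.IsHermitian) (Y : Matrix n n ℂ) :
    hsAdjoint (K X) Y = -K X Y := by
  have h : ∀ Z, hsInner (hsAdjoint (K X) Y + K X Y) Z = 0 := fun Z => by
    have := hsInner_hsAdjoint (K X) Z Y
    rw [hsInner, Matrix.conjTranspose_add, Matrix.add_mul, Matrix.trace_add, ← hsInner,
      ← hsInner, this, hsInner_K_left hX, add_neg_cancel]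
  exact eq_neg_of_add_eq_zero_left (eq_zero_of_hsInner_self (h _))

/-- `K_X` in vectorized form. -/
def vecK (X : Matrix n n ℂ) : EuclideanSpace ℂ (n × n) →L[ℝ] EuclideanSpace ℂ (n × n) :=
  vecMap ((K X).restrictScalars ℝ)

theorem vecK_vec (X Y : Matrix n n ℂ) : vecK X (vec n Y) = vec n (K X Y) :=
  vecMap_vec _ _

theorem inner_vecK_left {X : Matrix n n ℂ} (hX : X.IsHermitian) (u v : EuclideanSpace ℂ (n × n)) :
    ⟪vecK X u, v⟫ = -⟪u, vecK X v⟫ := by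
  obtain ⟨Y, rfl⟩ := (vec n).surjective u
  obtain ⟨Z, rfl⟩ := (vec n).surjective v
  rw [vecK_vec, vecK_vec, inner_vec, inner_vec, hsInner_K_left hX, Complex.neg_re]

/-- The conjugate transpose as a real-linear map. -/
def conjTransposeMap (n : Type*) : Matrix n n ℂ →ₗ[ℝ] Matrix n n ℂ where
  toFun := Matrix.conjTranspose
  map_add' := Matrix.conjTranspose_add
  map_smul' c X := by simp

/-- Solutions of a controlled von Neumann equation stay Hermitian. -/
theorem isHermitian_of_isBoundedPrimitive {T : ℝ} {s : ℝ → ℝ} {H G : Matrix n n ℂ}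
    (hH : H.IsHermitian) (hG : G.IsHermitian) {ρ : ℝ → Matrix n n ℂ}
    (hρ : IsBoundedPrimitive T (fun t => vec n (ρ t))
      (fun t => vecK H (vec n (ρ t)) + s t • vecK G (vec n (ρ t))))
    {a b : ℝ} (ha : a ∈ Icc 0 T) (hb : b ∈ Icc 0 T) (hρa : (ρ a).IsHermitian) :
    (ρ b).IsHermitian := by
  set J := vecMap (conjTransposeMap n) with hJ
  have hJv : ∀ X, J (vec n X) = vec n X.conjTranspose := fun X => vecMap_vec _ _
  -- ρ† - ρ solves the same equation and vanishes at `a`, hence everywhere by conservation of the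
  -- norm.
  have hd := ((hρ.map J).sub hρ).congr
    (g := fun t => vecK H (J (vec n (ρ t)) - vec n (ρ t)) +
      s t • vecK G (J (vec n (ρ t)) - vec n (ρ t))) fun t _ => by
    have hK : ∀ {X : Matrix n n ℂ}, X.IsHermitian →
        J (vecK X (vec n (ρ t))) = vecK X (J (vec n (ρ t))) := fun hX => by
      rw [vecK_vec, hJv, hJv, vecK_vec, conjTranspose_K hX]
    rw [map_add, map_smul, hK hH, hK hG, map_sub, map_sub, smul_sub]
    abel
  have hn := norm_eq_of_skew (inner_vecK_left hH) (inner_vecK_left hG) hd hb ha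
  simp only [hJv, hρa.eq, sub_self, norm_zero, norm_eq_zero, sub_eq_zero] at hn
  exact (vec n).injective hn

/-- Entrywise and vectorized integral equations agree. -/
theorem integral_equation_iff {T : ℝ} {s : ℝ → ℝ} (hs : IsControl T s) {H G : Matrix n n ℂ}
    {ρ : ℝ → Matrix n n ℂ} {b : ℝ} (hb : b ∈ Icc 0 T) {M : Matrix n n ℂ} :
    (ContinuousOn ρ (Icc 0 T) ∧ ∀ t ∈ Icc 0 T, ∀ i j,
      ρ t i j = M i j + ∫ τ in b..t, (K H (ρ τ) + (s τ : ℂ) • K G (ρ τ)) i j) ↔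
    ρ b = M ∧ IsBoundedPrimitive T (fun t => vec n (ρ t))
      (fun t => vecK H (vec n (ρ t)) + s t • vecK G (vec n (ρ t))) := by
  set f : ℝ → EuclideanSpace ℂ (n × n) :=
    fun t => vecK H (vec n (ρ t)) + s t • vecK G (vec n (ρ t)) with hf
  have hfe : ∀ τ i j, f τ (i, j) = (K H (ρ τ) + (s τ : ℂ) • K G (ρ τ)) i j := by
    intro τ i j
    simp [hf, vecK_vec, vec_apply]
  have hcomp : IntegrableOn f (Icc 0 T) → ∀ t ∈ Icc 0 T, ∀ i j,
      (∫ τ in b..t, f τ) (i, j) = ∫ τ in b..t, (K H (ρ τ) + (s τ : ℂ) • K G (ρ τ)) i j := by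
    intro hint t ht i j
    have := (PiLp.proj (𝕜 := ℝ) 2 (fun _ : n × n => ℂ) (i, j)).intervalIntegral_comp_comm
      (intervalIntegrable_of_integrableOn_Icc hint hb ht)
    simp only [PiLp.proj_apply] at this
    rw [← this]
    simp only [hfe]
  have h0 : (0 : ℝ) ∈ Icc 0 T := ⟨le_rfl, hb.1.trans hb.2⟩
  constructor
  · rintro ⟨hc, heq⟩
    -- Continuity of `ρ` yields integrability, without which the vector integral would be the
    -- default value 0 and could not be compared entrywise.
    obtain ⟨hint, hbd⟩ := hs.integrableOn_bounded (vecK H) (vecK G)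
      (x := fun t => vec n (ρ t)) ((vec n).continuous.comp_continuousOn hc)
    have hv : ∀ t ∈ Icc 0 T, vec n (ρ t) = vec n M + ∫ τ in b..t, f τ := by
      intro t ht
      ext ⟨i, j⟩
      rw [PiLp.add_apply, hcomp hint t ht, vec_apply, vec_apply, heq t ht]
    refine ⟨?_, hint, hbd, fun t ht => ?_⟩
    · ext i j
      simp [heq b hb]
    · rw [hv t ht, hv 0 h0, add_assoc, intervalIntegral.integral_add_adjacent_intervals
        (intervalIntegrable_of_integrableOn_Icc hint hb h0)
        (intervalIntegrable_of_integrableOn_Icc hint h0 ht)]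
  · rintro ⟨rfl, hρ⟩
    refine ⟨?_, fun t ht i j => ?_⟩
    · have := (vec n).symm.continuous.comp_continuousOn hρ.continuousOn
      simpa only [Function.comp_def, ContinuousLinearEquiv.symm_apply_apply] using this
    · rw [← hcomp hρ.integrableOn t ht, ← vec_apply (ρ t), ← vec_apply (ρ b), ← PiLp.add_apply]
      exact congrArg (· (i, j)) (hρ.eq_add_integral hb ht)

end Vectorization

open scoped ComplexOrder in
theorem IsDensity.isHermitian {n : Type*} [Fintype n] {X : Matrix n n ℂ} (hX : IsDensity X) :
    X.IsHermitian :=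
  hX.1.isHermitian

/-! ### Transfer to the open system. -/

namespace OpenSystem

variable {S E : Type*} [Fintype S] [Fintype E] [DecidableEq S] [DecidableEq E]

omit [Fintype S] [Fintype E] [DecidableEq S] in
theorem isHermitian_onSystem {X : Matrix S S ℂ} (hX : X.IsHermitian) :
    (onSystem E X).IsHermitian := by
  rw [Matrix.IsHermitian, onSystem, Matrix.conjTranspose_kronecker, hX.eq,
    Matrix.conjTranspose_one]

omit [Fintype S] [Fintype E] [DecidableEq S] in
theorem onSystem_sub (X Y : Matrix S S ℂ) :
    onSystem E (X - Y) = onSystem E X - onSystem E Y := by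
  ext ⟨i, e⟩ ⟨j, f⟩
  simp [onSystem, sub_mul]

variable (sys : OpenSystem S E)

omit [DecidableEq S] in
theorem isHermitian_onSystem_sub : (onSystem E (sys.B - sys.C)).IsHermitian :=
  isHermitian_onSystem (sys.hB.sub sys.hC)

theorem isHermitian_Htot (v : ℝ) : (sys.Htot v).IsHermitian := by
  refine ((isHermitian_onSystem (sys.hC.add ?_)).add sys.hHI).add ?_
  · rw [Matrix.IsHermitian, Matrix.conjTranspose_smul, (sys.hB.sub sys.hC).eq, Complex.star_def,
      Complex.conj_ofReal]
  · rw [Matrix.IsHermitian, Matrix.conjTranspose_kronecker, sys.hHE.eq, Matrix.conjTranspose_one]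

theorem Htot_eq (v : ℝ) :
    sys.Htot v = sys.Htot 0 + (v : ℂ) • onSystem E (sys.B - sys.C) := by
  ext ⟨i, e⟩ ⟨j, f⟩
  simp [Htot, onSystem]
  ring

theorem L_apply (v : ℝ) (X : Matrix (S × E) (S × E) ℂ) :
    sys.L v X = K (sys.Htot 0) X + (v : ℂ) • K (onSystem E (sys.B - sys.C)) X := by
  rw [L, sys.Htot_eq, K_add, K_smul]

/-- The vectorized trajectory `X` solves the controlled equation `X' = L_s X`. -/
def IsTrajectory (tf : ℝ) (s : ℝ → ℝ) (X : ℝ → Matrix (S × E) (S × E) ℂ) : Prop :=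
  IsBoundedPrimitive tf (fun t => vec (S × E) (X t))
    (fun t => vecK (sys.Htot 0) (vec (S × E) (X t)) +
      s t • vecK (onSystem E (sys.B - sys.C)) (vec (S × E) (X t)))

variable {sys} {tf : ℝ} {s : ℝ → ℝ} {p ρ : ℝ → Matrix (S × E) (S × E) ℂ}

theorem isAdmissible_iff (htf : 0 ≤ tf) :
    sys.IsAdmissible tf s ρ ↔
      IsControl tf s ∧ ρ 0 = sys.ρ₀ ⊗ₖ sys.ρE ∧ sys.IsTrajectory tf s ρ := by
  constructor
  · intro h
    have hs : IsControl tf s := ⟨h.measurable, h.mem⟩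
    refine ⟨hs, (integral_equation_iff hs ⟨le_rfl, htf⟩).1 ⟨h.continuousOn, fun t ht i j => ?_⟩⟩
    simp only [← L_apply]
    exact h.eq t ht i j
  · rintro ⟨hs, h0, h⟩
    obtain ⟨hc, heq⟩ := (integral_equation_iff hs ⟨le_rfl, htf⟩).2 ⟨h0, h⟩
    refine ⟨hs.measurable, hs.mem, hc, fun t ht i j => ?_⟩
    simpa only [← L_apply] using heq t ht i j

theorem isCostate_iff (htf : 0 ≤ tf) (hs : IsControl tf s) :
    sys.IsCostate tf s p ↔
      (∀ t ∈ Icc 0 tf, (p t).IsHermitian) ∧ p tf = -onSystem E sys.C ∧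
        sys.IsTrajectory tf s p := by
  -- The sign in L† = -L is absorbed by reversing the limits of integration, leaving the state
  -- equation based at `tf`.
  have hadj : ∀ t i j, (∫ τ in t..tf, hsAdjoint (sys.L (s τ)) (p τ) i j) =
      ∫ τ in tf..t, (sys.L (s τ) (p τ)) i j := by
    intro t i j
    rw [intervalIntegral.integral_symm, ← intervalIntegral.integral_neg]
    refine intervalIntegral.integral_congr fun τ _ => ?_
    simp only [L, hsAdjoint_K (sys.isHermitian_Htot _), Matrix.neg_apply, neg_neg]
  constructor
  · intro h
    refine ⟨h.hermitian, (integral_equation_iff hs ⟨htf, le_rfl⟩).1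
      ⟨h.continuousOn, fun t ht i j => ?_⟩⟩
    simp only [← L_apply]
    rw [← hadj]
    exact h.eq t ht i j
  · rintro ⟨hherm, hT, h⟩
    obtain ⟨hc, heq⟩ := (integral_equation_iff hs ⟨htf, le_rfl⟩).2 ⟨hT, h⟩
    refine ⟨hherm, hc, fun t ht i j => ?_⟩
    rw [hadj]
    simpa only [← L_apply] using heq t ht i j

theorem exists_isCostate (htf : 0 ≤ tf) (hs : IsControl tf s) : ∃ p, sys.IsCostate tf s p := by
  obtain ⟨x, hxT, hx⟩ := exists_controlled_solution_terminal htf hs (vecK (sys.Htot 0))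
    (vecK (onSystem E (sys.B - sys.C))) (vec (S × E) (-onSystem E sys.C))
  obtain ⟨p, rfl⟩ : ∃ p : ℝ → Matrix (S × E) (S × E) ℂ, x = fun t => vec (S × E) (p t) :=
    ⟨fun t => (vec (S × E)).symm (x t), by simp⟩
  have hpT : p tf = -onSystem E sys.C := (vec (S × E)).injective hxT
  refine ⟨p, (isCostate_iff htf hs).2 ⟨fun t ht => ?_, hpT, hx⟩⟩
  refine isHermitian_of_isBoundedPrimitive (sys.isHermitian_Htot 0) sys.isHermitian_onSystem_sub
    hx ⟨htf, le_rfl⟩ ht ?_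
  rw [hpT]
  exact (isHermitian_onSystem sys.hC).neg

omit [DecidableEq S] in
theorem cost_eq_inner (X : Matrix (S × E) (S × E) ℂ) :
    sys.cost X = ⟪vec (S × E) (onSystem E sys.C), vec (S × E) X⟫ := by
  rw [inner_vec, hsInner, (isHermitian_onSystem sys.hC).eq, cost]

theorem switching_re (X Y : Matrix (S × E) (S × E) ℂ) :
    (sys.switching X Y).re =
      ⟪vec (S × E) X, vecK (onSystem E (sys.B - sys.C)) (vec (S × E) Y)⟫ := by
  rw [vecK_vec, inner_vec, switching]

theorem switching_im_eq_zero {X Y : Matrix (S × E) (S × E) ℂ} (hX : X.IsHermitian)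
    (hY : Y.IsHermitian) : (sys.switching X Y).im = 0 := by
  refine hsInner_im_eq_zero hX ?_
  rw [Matrix.IsHermitian, conjTranspose_K sys.isHermitian_onSystem_sub, hY.eq]

theorem switching_eq_sub (X Y : Matrix (S × E) (S × E) ℂ) :
    sys.switching X Y =
      hsInner X (K (onSystem E sys.B) Y) - hsInner X (K (onSystem E sys.C) Y) := by
  rw [switching, onSystem_sub, K_sub, hsInner_sub_right]

theorem pmpH_eq (X Y : Matrix (S × E) (S × E) ℂ) (v : ℝ) :
    sys.pmpH X Y v = hsInner X (K (sys.Htot 0) Y) + v * sys.switching X Y := by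
  rw [pmpH, L_apply, hsInner_add_right, hsInner_smul_right, switching]

/-- The control Hamiltonian is affine in `v` with slope `switching`, so comparing v = 0 and v = 1
decides. -/
theorem pmpH_independent_iff (X Y : Matrix (S × E) (S × E) ℂ) :
    (∀ v ∈ Icc (0 : ℝ) 1, ∀ w ∈ Icc (0 : ℝ) 1, sys.pmpH X Y v = sys.pmpH X Y w) ↔
      sys.switching X Y = 0 := by
  constructor
  · intro h
    have := h 1 (by simp) 0 (by simp)
    simpa [pmpH_eq] using this
  · intro h v _ w _
    simp [pmpH_eq, h]

omit [DecidableEq S] in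
theorem onSystem_C_ne_zero (hC : sys.C ≠ 0) : onSystem E sys.C ≠ 0 := by
  intro h
  -- Over an empty environment `C ⊗ 1` would vanish; the unit trace of `ρE` excludes this.
  have hE : Nonempty E := by
    by_contra hne
    rw [not_nonempty_iff] at hne
    have := sys.hρE.2
    simp [Matrix.trace] at this
  obtain ⟨e⟩ := hE
  refine hC ?_
  ext i j
  simpa [onSystem] using congrFun (congrFun h (i, e)) (j, e)

theorem IsTrajectory.ne_zero {a b : ℝ} (hp : sys.IsTrajectory tf s p) (ha : a ∈ Icc 0 tf)
    (hb : b ∈ Icc 0 tf) (h : p a ≠ 0) : p b ≠ 0 := by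
  intro h0
  have := norm_eq_of_skew (inner_vecK_left (sys.isHermitian_Htot 0))
    (inner_vecK_left sys.isHermitian_onSystem_sub) hp ha hb
  rw [h0, map_zero, norm_zero, norm_eq_zero] at this
  exact h ((vec (S × E)).injective (this.trans (map_zero _).symm))

theorem IsAdmissible.isHermitian (htf : 0 ≤ tf) (h : sys.IsAdmissible tf s ρ) {t : ℝ}
    (ht : t ∈ Icc 0 tf) : (ρ t).IsHermitian := by
  obtain ⟨-, h0, hρ⟩ := (isAdmissible_iff htf).1 h
  refine isHermitian_of_isBoundedPrimitive (sys.isHermitian_Htot 0) sys.isHermitian_onSystem_sub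
    hρ ⟨le_rfl, htf⟩ ht ?_
  rw [h0, Matrix.IsHermitian, Matrix.conjTranspose_kronecker, sys.hρ₀.isHermitian.eq,
    sys.hρE.isHermitian.eq]

theorem IsOptimal.bang (htf : 0 ≤ tf) (hopt : sys.IsOptimal tf s ρ)
    (hp : sys.IsCostate tf s p) :
    ∀ᵐ t ∂(volume.restrict (Icc 0 tf)),
      ((sys.switching (p t) (ρ t)).re < 0 → s t = 0) ∧
        (0 < (sys.switching (p t) (ρ t)).re → s t = 1) := by
  obtain ⟨hs, h0, hρ⟩ := (isAdmissible_iff htf).1 hopt.1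
  obtain ⟨-, hpT, hp⟩ := (isCostate_iff htf hs).1 hp
  simp only [switching_re]
  refine bang_of_optimal (q := vec (S × E) (onSystem E sys.C)) htf
    (inner_vecK_left (sys.isHermitian_Htot 0)) (inner_vecK_left sys.isHermitian_onSystem_sub)
    hs rfl hρ hp (by rw [hpT, map_neg]) fun r y hr hy0 hy => ?_
  obtain ⟨σ, rfl⟩ : ∃ σ : ℝ → Matrix (S × E) (S × E) ℂ, y = fun t => vec (S × E) (σ t) :=
    ⟨fun t => (vec (S × E)).symm (y t), by simp⟩
  rw [← cost_eq_inner, ← cost_eq_inner]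
  exact hopt.2 r σ ((isAdmissible_iff htf).2
    ⟨hr, ((vec (S × E)).injective hy0).trans h0, hy⟩)

theorem continuousOn_switching_re (hp : sys.IsTrajectory tf s p) (hρ : sys.IsTrajectory tf s ρ) :
    ContinuousOn (fun t => (sys.switching (p t) (ρ t)).re) (Icc 0 tf) := by
  simp only [switching_re]
  exact hp.continuousOn.inner ((vecK _).continuous.comp_continuousOn hρ.continuousOn)

end OpenSystem

end

end OpenAnneal

open OpenAnneal
theorem corollary1 {S E : Type*} [Fintype S] [Fintype E] [DecidableEq S] [DecidableEq E]
    (sys : OpenSystem S E) (tf : ℝ) (htf : 0 < tf)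
    (s : ℝ → ℝ) (ρ : ℝ → Matrix (S × E) (S × E) ℂ) (hopt : sys.IsOptimal tf s ρ) :
    (∃ p, sys.IsCostate tf s p) ∧
    ∀ p, sys.IsCostate tf s p →
      (sys.C ≠ 0 → ∀ t ∈ Icc 0 tf, p t ≠ 0) ∧
      -- the function whose sign is used is real
      (∀ t ∈ Icc 0 tf, (sys.switching (p t) (ρ t)).im = 0) ∧
      -- the interval is an alternation of bang arcs and singular arcs
      sys.IsAlternation tf p ρ ∧
      -- bang arcs
      (∀ I, sys.IsNegArc tf p ρ I → ∀ᵐ t ∂(volume.restrict I), s t = 0) ∧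
      (∀ I, sys.IsPosArc tf p ρ I → ∀ᵐ t ∂(volume.restrict I), s t = 1) ∧
      -- singular arcs
      (∀ I, sys.IsSingularArc tf p ρ I → ∀ t ∈ I,
        hsInner (p t) (K (onSystem E sys.C) (ρ t)) =
          hsInner (p t) (K (onSystem E sys.B) (ρ t))) ∧
      -- and, in fact, at every time of the interval outside the bang arcs
      (∀ t ∈ Icc 0 tf, (sys.switching (p t) (ρ t)).re = 0 →
        hsInner (p t) (K (onSystem E sys.C) (ρ t)) =
          hsInner (p t) (K (onSystem E sys.B) (ρ t))) := by
  obtain ⟨hs, -, hρ⟩ := (OpenSystem.isAdmissible_iff htf.le).1 hopt.1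
  refine ⟨OpenSystem.exists_isCostate htf.le hs, fun p hp => ?_⟩
  obtain ⟨hpH, hpT, hpt⟩ := (OpenSystem.isCostate_iff htf.le hs).1 hp
  have him : ∀ t ∈ Icc 0 tf, (sys.switching (p t) (ρ t)).im = 0 := fun t ht =>
    OpenSystem.switching_im_eq_zero (hpH t ht) (hopt.1.isHermitian htf.le ht)
  have hsing : ∀ t ∈ Icc 0 tf, (sys.switching (p t) (ρ t) = 0 ↔
      (sys.switching (p t) (ρ t)).re = 0) := fun t ht => by
    rw [Complex.ext_iff, him t ht]
    simp
  have hbang := hopt.bang htf.le hp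
  have hae : ∀ I, OpenSystem.IsArc tf I → (MeasurableSet I ∧ ∀ᵐ t ∂(volume.restrict I),
      ((sys.switching (p t) (ρ t)).re < 0 → s t = 0) ∧
        (0 < (sys.switching (p t) (ρ t)).re → s t = 1)) := fun I hI =>
    ⟨hI.2.1.measurableSet, ae_mono (Measure.restrict_mono hI.1 le_rfl) hbang⟩
  refine ⟨fun hC t ht => hpt.ne_zero ⟨htf.le, le_rfl⟩ ht ?_, him, ?_, fun I hI => ?_,
    fun I hI => ?_, fun I hI t ht => ?_, fun t ht h0 => ?_⟩
  · rw [hpT]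
    exact neg_ne_zero.2 (OpenSystem.onSystem_C_ne_zero hC)
  · have hZ : sys.singularArcs tf p ρ =
        maximalArcs tf (fun t => (sys.switching (p t) (ρ t)).re = 0) :=
      maximalArcs_congr fun t ht =>
        (OpenSystem.pmpH_independent_iff (p t) (ρ t)).trans (hsing t ht)
    rw [OpenSystem.IsAlternation, hZ]
    exact alternation_of_continuousOn htf (OpenSystem.continuousOn_switching_re hpt hρ)
  · obtain ⟨hm, h⟩ := hae I hI.1
    filter_upwards [h, ae_restrict_mem hm] with t ht htI using ht.1 (hI.2 t htI)
  · obtain ⟨hm, h⟩ := hae I hI.1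
    filter_upwards [h, ae_restrict_mem hm] with t ht htI using ht.2 (hI.2 t htI)
  · have := (OpenSystem.pmpH_independent_iff (p t) (ρ t)).1 (hI.2 t ht)
    rw [OpenSystem.switching_eq_sub, sub_eq_zero] at this
    exact this.symm
  · have := (hsing t ht).2 h0
    rw [OpenSystem.switching_eq_sub, sub_eq_zero] at this
    exact this.symm
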